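/- Let $G=(V,E)$ be a finite directed graph (self-loops allowed), and let $O\subseteq V$ be the set of observed nodes. Consider the linear systems $\dot x=Ax$, $y=Cx$ with states $x_v$ $(v\in V)$ and outputs $y_o$ $(o\in O)$, where $A\in\mathbb R^{V\times V}$ has the zero-nonzero pattern of $G$ ($A_{ba}\neq 0$ if and only if $ab\in E$, where $ab$ is the link from $a$ to $b$), and $C\in\mathbb R^{O\times V}$ has $C_{ov}\ne 0$ if and only if $v=o$ (each observed node is measured by an output of its own). Such a system is observable if, for some finite $T>0$, the output on $[0,T]$ determines the initial state. The network $(G,O)$ is structurally observable if the system is observable for some choice of the nonzero entries of $A$ and $C$; it is generically observable if the system is observable for Lebesgue-almost all values of these entries. A matching is a set of links no two of which share a start node or share an end node; a maximum matching is one of the largest possible size; a node is unmatched by a matching if it is not the start node of any of its links. A parent SCC is a strongly connected component of $G$ that no link leaves, where a single node without any outgoing link (not even a self-loop) is not counted. Theorem. The network $(G,O)$ is structurally observable if and only if (i) for some maximum matching, every unmatched node is in $O$; and (ii) every parent SCC contains at least one node of $O$. Moreover, $(G,O)$ is generically observable if and only if (i) and (ii) hold. -/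

import Mathlib

namespace StructObs

/-! ### Linear systems and observability -/

/-- `x` is a trajectory of the linear system `x' = A x`. -/
def IsTrajectory {V : Type*} [Fintype V] (A : Matrix V V ℝ) (x : ℝ → V → ℝ) : Prop :=
  ∀ t : ℝ, HasDerivAt x (A.mulVec (x t)) t

/-- The system `x' = A x`, `y = C x` is observable: there is a finite time `T > 0` such that the
output on `[0, T]` determines the initial state (and hence the whole trajectory). -/
def IsObservable {V P : Type*} [Fintype V] (A : Matrix V V ℝ) (C : Matrix P V ℝ) : Prop :=
  ∃ T : ℝ, 0 < T ∧ ∀ x x' : ℝ → V → ℝ, IsTrajectory A x → IsTrajectory A x' →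
    (∀ t ∈ Set.Icc 0 T, C.mulVec (x t) = C.mulVec (x' t)) → x 0 = x' 0

/-! ### Structured systems

A network is a digraph `G` on a finite node set `V` (self-loops allowed), together with the set
`O` of observed nodes. Each node carries one real state; a link from `a` to `b` means that the
state of `a` enters the equation of the state of `b`. Each observed node is measured by an output
of its own. -/

/-- `A` is a system matrix with the zero-nonzero pattern of `G`. -/
def HasStructure {V : Type*} (G : Digraph V) (A : Matrix V V ℝ) : Prop :=
  ∀ a b : V, A b a ≠ 0 ↔ G.Adj a b

/-- `C` is an output matrix with one output for each node of `O`, measuring exactly that node. -/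
def IsOutputMatrix {V : Type*} (O : Finset V) (C : Matrix O V ℝ) : Prop :=
  ∀ (o : O) (v : V), C o v ≠ 0 ↔ v = o

/-- Structural observability: some choice of the nonzero entries gives an observable system. -/
def IsStructurallyObservable {V : Type*} [Fintype V] (G : Digraph V) (O : Finset V) : Prop :=
  ∃ (A : Matrix V V ℝ) (C : Matrix O V ℝ),
    HasStructure G A ∧ IsOutputMatrix O C ∧ IsObservable A C

/-- The links of `G`, as ordered pairs (start node, end node). -/
abbrev Link {V : Type*} (G : Digraph V) : Type _ := {e : V × V // G.Adj e.1 e.2}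

/-- The system matrix of `G` with link weights `w`. -/
def systemMatrix {V : Type*} (G : Digraph V) [DecidableRel G.Adj] (w : Link G → ℝ) :
    Matrix V V ℝ :=
  Matrix.of fun b a => if h : G.Adj a b then w ⟨(a, b), h⟩ else 0

/-- The output matrix with gain `c o` for the observed node `o`. -/
def outputMatrix {V : Type*} [DecidableEq V] (O : Finset V) (c : O → ℝ) : Matrix O V ℝ :=
  Matrix.of fun o v => if v = o then c o else 0

/-- Generic observability: the system is observable for Lebesgue-almost all values of the link
weights and output gains. -/
def IsGenericallyObservable {V : Type*} [Fintype V] [DecidableEq V]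
    (G : Digraph V) [DecidableRel G.Adj] (O : Finset V) : Prop :=
  ∀ᵐ p : (Link G → ℝ) × (O → ℝ) ∂MeasureTheory.volume,
    IsObservable (systemMatrix G p.1) (outputMatrix O p.2)

/-! ### Matchings -/

/-- A matching: a set of links, no two of which share a start node or share an end node. -/
def IsMatching {V : Type*} (G : Digraph V) (M : Finset (V × V)) : Prop :=
  (∀ e ∈ M, G.Adj e.1 e.2) ∧
    ∀ e ∈ M, ∀ f ∈ M, e ≠ f → e.1 ≠ f.1 ∧ e.2 ≠ f.2

/-- A maximum matching: a matching of the largest possible size. -/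
def IsMaximumMatching {V : Type*} (G : Digraph V) (M : Finset (V × V)) : Prop :=
  IsMatching G M ∧ ∀ M' : Finset (V × V), IsMatching G M' → M'.card ≤ M.card

/-- `v` is unmatched by `M`: it is not the start node of a link of `M`. -/
def IsUnmatched {V : Type*} (M : Finset (V × V)) (v : V) : Prop :=
  ∀ e ∈ M, e.1 ≠ v

/-! ### Strongly connected components -/

/-- There is a directed path (possibly of length zero) from `a` to `b`. -/
def Reaches {V : Type*} (G : Digraph V) (a b : V) : Prop :=
  Relation.ReflTransGen G.Adj a b

/-- `S` is a strongly connected component: a class of mutually reachable nodes. -/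
def IsSCC {V : Type*} (G : Digraph V) (S : Set V) : Prop :=
  ∃ a : V, S = {b | Reaches G a b ∧ Reaches G b a}

/-- `S` is a parent SCC: a strongly connected component without outgoing links to other
components. A single node without any outgoing link (not even a self-loop) is a *parent node*
and is not counted as a parent SCC; hence the last clause. -/
def IsParentSCC {V : Type*} (G : Digraph V) (S : Set V) : Prop :=
  IsSCC G S ∧ (∀ a b : V, a ∈ S → G.Adj a b → b ∈ S) ∧ ∃ a ∈ S, ∃ b, G.Adj a b

/-- For some maximum matching, all unmatched nodes are observed. (The maximum matching need not
be unique.) -/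
def UnmatchedObserved {V : Type*} (G : Digraph V) (O : Finset V) : Prop :=
  ∃ M : Finset (V × V), IsMaximumMatching G M ∧ ∀ v : V, IsUnmatched M v → v ∈ O

/-- At least one node of every parent SCC is observed. -/
def ParentSCCsObserved {V : Type*} (G : Digraph V) (O : Finset V) : Prop :=
  ∀ S : Set V, IsParentSCC G S → ∃ v ∈ S, v ∈ O

end StructObs

open Matrix

namespace StructObs

/-! ### Invariant subspaces and the Kalman criterion -/

/-! Necessity: in an observable system no nonzero `A`-invariant subspace lies in `ker C`. For `ker A
⊓ ker C` this makes the columns of `A` at unobserved nodes independent, which is Hall's condition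
for matching those nodes; a second use of Hall yields a maximum matching
(`unmatchedObserved_of_injective`). For the vectors supported on a parent SCC it forces an observed
node there.

Sufficiency: the matching extends to a permutation `σ` that follows links off `O`, and (ii) gives
every node a path to `O`. An observable system is built cycle by cycle: start with the cycles of `σ`
meeting `O`, then repeatedly attach a cycle by one link into the part already built, with a weight
avoiding finitely many resonances (`IsRealizableOn.extend`, `finite_setOf_resolvent_mem`).
Observability is nonvanishing of a determinant polynomial in the weights, so this one example, even
with some zero weights, gives observability almost everywhere. Almost all weights are also nonzero,
whence structural observability. -/

theorem exists_hasDerivAt_eq_apply {E : Type*} [NormedAddCommGroup E] [NormedSpace ℝ E]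
    [CompleteSpace E] (f : E →L[ℝ] E) (u : E) :
    ∃ x : ℝ → E, (∀ t, HasDerivAt x (f (x t)) t) ∧ x 0 = u := by
  refine ⟨fun t => NormedSpace.exp (t • f) u, fun t => ?_, by simp⟩
  exact (ContinuousLinearMap.apply ℝ E u).hasFDerivAt.comp_hasDerivAt t
    (hasDerivAt_exp_smul_const' (𝕂 := ℝ) f t)

theorem exists_trajectory_of_invariant {V : Type*} [Fintype V] (A : Matrix V V ℝ)
    (U : Submodule ℝ (V → ℝ)) (hA : ∀ x ∈ U, A *ᵥ x ∈ U) (u : V → ℝ) (hu : u ∈ U) :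
    ∃ x : ℝ → V → ℝ, IsTrajectory A x ∧ x 0 = u ∧ ∀ t, x t ∈ U := by
  have : CompleteSpace U := FiniteDimensional.complete ℝ U
  obtain ⟨x, hx, hx0⟩ := exists_hasDerivAt_eq_apply
    (LinearMap.toContinuousLinearMap (A.mulVecLin.restrict hA)) (⟨u, hu⟩ : U)
  refine ⟨fun t => x t, fun t => ?_, by simp [hx0], fun t => (x t).2⟩
  exact U.subtypeL.hasFDerivAt.comp_hasDerivAt t (hx t)

/-- A trajectory started in `U` stays there, so its output is the zero output of the rest state. -/
theorem IsObservable.eq_bot_of_invariant {V P : Type*} [Fintype V] {A : Matrix V V ℝ}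
    {C : Matrix P V ℝ} (h : IsObservable A C) (U : Submodule ℝ (V → ℝ))
    (hA : ∀ x ∈ U, A *ᵥ x ∈ U) (hC : ∀ x ∈ U, C *ᵥ x = 0) : U = ⊥ := by
  obtain ⟨T, -, hT⟩ := h
  refine (Submodule.eq_bot_iff _).2 fun u hu => ?_
  obtain ⟨x, hx, hx0, hxU⟩ := exists_trajectory_of_invariant A U hA u hu
  have h0 : IsTrajectory A fun _ => 0 := fun t => by
    simpa using hasDerivAt_const t (0 : V → ℝ)
  rw [← hx0]
  exact hT x _ hx h0 fun t _ => by simp [hC _ (hxU t)]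

theorem IsTrajectory.output_derivatives_eq_zero {V P : Type*} [Fintype V] [DecidableEq V]
    {A : Matrix V V ℝ} {C : Matrix P V ℝ} {z : ℝ → V → ℝ} (hz : IsTrajectory A z) {T : ℝ}
    (hT : 0 < T) (hC : ∀ t ∈ Set.Icc 0 T, C *ᵥ z t = 0) (k : ℕ) :
    ∀ t ∈ Set.Icc 0 T, (C * A ^ k) *ᵥ z t = 0 := by
  induction k with
  | zero => simpa using hC
  | succ k ih =>
    intro t ht
    funext p
    have h1 : HasDerivAt (fun s => ((C * A ^ k) *ᵥ z s) p) (((C * A ^ k) *ᵥ (A *ᵥ z t)) p) t := by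
      simp only [mulVec, dotProduct]
      refine HasDerivAt.fun_sum fun v _ => ?_
      exact ((hasDerivAt_pi.1 (hz t)) v).const_mul _
    -- The output is known only on the interval, so derivatives are compared within it; this covers
    -- the endpoint `0`, where the Kalman criterion is read off.
    have h2 : HasDerivWithinAt (fun s => ((C * A ^ k) *ᵥ z s) p) 0 (Set.Icc 0 T) t :=
      (hasDerivWithinAt_const t (Set.Icc 0 T) (0 : ℝ)).congr (fun s hs => by simp [ih s hs])
        (by simp [ih t ht])
    have h3 := (uniqueDiffOn_Icc hT t ht).eq_deriv _ h1.hasDerivWithinAt h2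
    rw [pow_succ, ← Matrix.mul_assoc, ← mulVec_mulVec]
    exact h3

theorem isObservable_of_kalman {V P : Type*} [Fintype V] [DecidableEq V] {A : Matrix V V ℝ}
    {C : Matrix P V ℝ} (h : ∀ x : V → ℝ, (∀ k, (C * A ^ k) *ᵥ x = 0) → x = 0) :
    IsObservable A C := by
  refine ⟨1, one_pos, fun x x' hx hx' hC => sub_eq_zero.1 (h _ fun k => ?_)⟩
  have hz : IsTrajectory A fun t => x t - x' t := fun t => by
    rw [mulVec_sub]; exact (hx t).sub (hx' t)
  exact hz.output_derivatives_eq_zero one_pos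
    (fun t ht => by rw [mulVec_sub, hC t ht, sub_self]) k 0 (by simp)

/-! ### Matchings covering the unobserved nodes -/

section Matching
variable {V : Type*} {G : Digraph V} {M : Finset (V × V)}

theorem IsMatching.fst_inj (hM : IsMatching G M) {e f : V × V} (he : e ∈ M) (hf : f ∈ M)
    (h : e.1 = f.1) : e = f :=
  by_contra fun hne => (hM.2 e he f hf hne).1 h

theorem IsMatching.snd_inj (hM : IsMatching G M) {e f : V × V} (he : e ∈ M) (hf : f ∈ M)
    (h : e.2 = f.2) : e = f :=
  by_contra fun hne => (hM.2 e he f hf hne).2 h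

theorem exists_isMaximumMatching [Finite V] (G : Digraph V) : ∃ M, IsMaximumMatching G M := by
  classical
  cases nonempty_fintype V
  obtain ⟨M, hM, hmax⟩ := Finset.exists_max_image
    (Finset.univ.filter fun M : Finset (V × V) => IsMatching G M) Finset.card
    ⟨∅, by simp [IsMatching]⟩
  exact ⟨M, by simpa using hM, fun M' hM' => hmax M' (by simpa using hM')⟩

/-- A matching sends matched nodes to their partners and keeps the unmatched ones apart. -/
theorem IsMatching.exists_injective_sum (hM : IsMatching G M) :
    ∃ h : V → V ⊕ {v // IsUnmatched M v}, Function.Injective h ∧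
      ∀ v b, h v = Sum.inl b → G.Adj v b := by
  classical
  have key : ∀ v, ∃ s : V ⊕ {v // IsUnmatched M v},
      (∀ b, s = Sum.inl b → (v, b) ∈ M) ∧ ∀ d, s = Sum.inr d → d.1 = v := by
    intro v
    by_cases hv : IsUnmatched M v
    · exact ⟨Sum.inr ⟨v, hv⟩, by simp, by rintro d ⟨⟩; rfl⟩
    · simp only [IsUnmatched, not_forall, not_not] at hv
      obtain ⟨e, he, rfl⟩ := hv
      exact ⟨Sum.inl e.2, by rintro b ⟨⟩; exact he, by simp⟩
  choose h h1 h2 using key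
  refine ⟨h, fun v w hvw => ?_, fun v b hb => hM.1 _ (h1 v b hb)⟩
  rcases hv : h v with b | d
  · exact congrArg Prod.fst (hM.snd_inj (h1 v b hv) (h1 w b (hvw ▸ hv)) rfl)
  · rw [← h2 v d hv, ← h2 w d (hvw ▸ hv)]

theorem IsMatching.card_add_card_unmatched_le [Fintype V] (hM : IsMatching G M)
    [Fintype {v // IsUnmatched M v}] :
    M.card + Fintype.card {v // IsUnmatched M v} ≤ Fintype.card V := by
  rw [← Fintype.card_coe M, ← Fintype.card_sum]
  refine Fintype.card_le_of_injective (Sum.elim (fun e => e.1.1) fun d => d.1) ?_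
  refine Function.Injective.sumElim (fun e f h => Subtype.ext (hM.fst_inj e.2 f.2 h))
    Subtype.val_injective fun e d h => d.2 e.1 e.2 h

/-- Add one dummy target for each node that a maximum matching `M` leaves unmatched, open to
observed nodes only. Hall's theorem then injects all of `V`. The real links used form a matching at
least as large as `M`, and nodes sent to dummies are observed. -/
theorem unmatchedObserved_of_injective [Fintype V] {O : Finset V} (f : {v // v ∉ O} → V)
    (hf : Function.Injective f) (hadj : ∀ v, G.Adj v.1 (f v)) : UnmatchedObserved G O := by
  classical
  obtain ⟨M, hM, hmax⟩ := exists_isMaximumMatching G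
  obtain ⟨h, hinj, hh⟩ := hM.exists_injective_sum
  let r : V → V ⊕ {v // IsUnmatched M v} → Prop :=
    fun a => Sum.elim (fun b => G.Adj a b) fun _ => a ∈ O
  have hall : ∀ A : Finset V, A.card ≤
      (Finset.univ.filter fun b : V ⊕ {v // IsUnmatched M v} => ∃ a ∈ A, r a b).card := by
    intro A
    by_cases hA : ∃ a ∈ A, a ∈ O
    · obtain ⟨o, hoA, hoO⟩ := hA
      refine Finset.card_le_card_of_injOn h (fun a ha => ?_) hinj.injOn
      simp only [Finset.coe_filter, Finset.mem_univ, true_and, Set.mem_ofPred_eq]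
      rcases hb : h a with b | d
      · exact ⟨a, ha, hh a b hb⟩
      · exact ⟨o, hoA, hoO⟩
    · push Not at hA
      -- The branch `h a` is a filler: no node of this `A` is observed.
      refine Finset.card_le_card_of_injOn
        (fun a => if ha : a ∈ O then h a else Sum.inl (f ⟨a, ha⟩)) (fun a ha => ?_) ?_
      · simp only [hA a ha, Finset.coe_filter, Finset.mem_univ, true_and, Set.mem_ofPred_eq]
        exact ⟨a, ha, hadj ⟨a, hA a ha⟩⟩
      · intro a ha b hb hab
        simp only [hA a ha, hA b hb, dite_false, Sum.inl.injEq] at hab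
        exact congrArg Subtype.val (hf hab)
  obtain ⟨g, ginj, hg⟩ := (Fintype.all_card_le_filter_rel_iff_exists_injective r).1 hall
  let N : Finset (V × V) := Finset.univ.filter fun e => g e.1 = Sum.inl e.2
  have hN : ∀ e, e ∈ N ↔ g e.1 = Sum.inl e.2 := fun e => by simp [N]
  refine ⟨N, ⟨⟨fun e he => ?_, fun e he e' he' hne => ⟨fun h1 => hne ?_, fun h2 => hne ?_⟩⟩,
    fun M' hM' => (hmax M' hM').trans ?_⟩, fun v hv => ?_⟩
  · have := hg e.1
    rw [(hN e).1 he] at this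
    exact this
  · refine Prod.ext h1 (Sum.inl_injective (β := {v // IsUnmatched M v}) ?_)
    rw [← (hN e).1 he, ← (hN e').1 he', h1]
  · refine Prod.ext (ginj ?_) h2
    rw [(hN e).1 he, (hN e').1 he', h2]
  · refine Nat.le_of_add_le_add_right (hM.card_add_card_unmatched_le.trans ?_)
    rw [← Fintype.card_coe N, ← Fintype.card_sum]
    have key : ∀ v, ∃ s : N ⊕ {v // IsUnmatched M v}, Sum.map (fun e => e.1.2) id s = g v := by
      intro v
      rcases hv : g v with b | d
      · exact ⟨Sum.inl ⟨(v, b), (hN _).2 hv⟩, rfl⟩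
      · exact ⟨Sum.inr d, rfl⟩
    choose s hs using key
    exact Fintype.card_le_of_injective s fun v w hvw => ginj (by rw [← hs v, ← hs w, hvw])
  · have := hg v
    rcases hb : g v with b | d
    · exact absurd rfl (hv (v, b) ((hN _).2 hb))
    · rw [hb] at this
      exact this

/-- Values of `σ` on `O` merely complete a bijection and need not follow links. -/
theorem UnmatchedObserved.exists_perm [Finite V] {O : Finset V} (h : UnmatchedObserved G O) :
    ∃ σ : Equiv.Perm V, ∀ v ∉ O, G.Adj v (σ v) := by
  obtain ⟨M, ⟨hM, -⟩, hO⟩ := h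
  have key : ∀ v : {v // v ∉ O}, ∃ b, (v.1, b) ∈ M := by
    rintro ⟨v, hv⟩
    by_contra hb
    push Not at hb
    exact hv (hO v fun e he hev => hb e.2 (hev ▸ he))
  choose f hf using key
  obtain ⟨σ, hσ⟩ := Equiv.Perm.exists_extending_pair Subtype.val f Subtype.val_injective
    fun v w hvw => Subtype.ext (congrArg Prod.fst (hM.snd_inj (hf v) (hf w) hvw))
  exact ⟨σ, fun v hv => hσ ⟨v, hv⟩ ▸ hM.1 _ (hf ⟨v, hv⟩)⟩

end Matching

/-! ### Necessity -/

section Necessity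
variable {V : Type*} [Fintype V] {G : Digraph V} {O : Finset V} {A : Matrix V V ℝ}
  {C : Matrix O V ℝ}

theorem mulVec_eq_zero_of_isOutputMatrix (hC : IsOutputMatrix O C) {x : V → ℝ}
    (hx : ∀ v ∈ O, x v = 0) : C *ᵥ x = 0 := by
  funext o
  refine Finset.sum_eq_zero fun v _ => ?_
  by_cases hv : v = o
  · rw [hx v (hv ▸ o.2), mul_zero]
  · exact mul_eq_zero_of_left (not_not.1 fun h => hv ((hC o v).1 h)) _

theorem IsObservable.unmatchedObserved (hA : HasStructure G A) (hC : IsOutputMatrix O C)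
    (h : IsObservable A C) : UnmatchedObserved G O := by
  classical
  have hker : ∀ x, A *ᵥ x = 0 → C *ᵥ x = 0 → x = 0 := by
    intro x hx hCx
    have hU := h.eq_bot_of_invariant (LinearMap.ker A.mulVecLin ⊓ LinearMap.ker C.mulVecLin)
      (fun y hy => by
        have : A *ᵥ y = 0 := hy.1
        rw [this]; exact Submodule.zero_mem _) fun y hy => hy.2
    exact (Submodule.eq_bot_iff _).1 hU x ⟨hx, hCx⟩
  suffices hall : ∀ S : Finset {v // v ∉ O},
      S.card ≤ (Finset.univ.filter fun b => ∃ a ∈ S, G.Adj a.1 b).card by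
    obtain ⟨f, hf, hadj⟩ := (Fintype.all_card_le_filter_rel_iff_exists_injective _).1 hall
    exact unmatchedObserved_of_injective f hf hadj
  intro S
  by_contra hlt
  push Not at hlt
  let N := Finset.univ.filter fun b => ∃ a ∈ S, G.Adj a.1 b
  -- More columns than rows would give a kernel vector `y`; its extension by zero is killed by `A`,
  -- since no link from `S` ends outside `N`, and by `C`.
  have hnot := LinearMap.ker_ne_bot_of_finrank_lt
    (f := (A.submatrix (fun b : N => b.1) (fun a : S => a.1.1)).mulVecLin)
    (by simpa only [Module.finrank_fintype_fun_eq_card, Fintype.card_coe] using hlt)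
  refine hnot ((Submodule.eq_bot_iff _).2 fun y hy => ?_)
  have hinj : Function.Injective fun a : S => a.1.1 :=
    Subtype.val_injective.comp Subtype.val_injective
  let x : V → ℝ := Function.extend (fun a : S => a.1.1) y (0 : V → ℝ)
  have hx : ∀ a : S, x a.1.1 = y a := fun a => hinj.extend_apply y (0 : V → ℝ) a
  have hx0 : ∀ v, (∀ a : S, a.1.1 ≠ v) → x v = 0 := fun v hv =>
    Function.extend_apply' y (0 : V → ℝ) v fun ⟨a, ha⟩ => hv a ha
  have hsum : ∀ b, (A *ᵥ x) b = ∑ a : S, A b a.1.1 * y a := by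
    intro b
    simp only [← hx]
    refine (Fintype.sum_of_injective _ hinj _ _ (fun v hv => ?_) fun _ => rfl).symm
    exact mul_eq_zero_of_right _ (hx0 v fun a ha => hv ⟨a, ha⟩)
  have hx_zero : x = 0 := by
    refine hker x (funext fun b => ?_) (mulVec_eq_zero_of_isOutputMatrix hC fun v hv =>
      hx0 v fun a ha => a.1.2 (ha ▸ hv))
    rw [hsum b]
    by_cases hb : b ∈ N
    · exact congrFun (LinearMap.mem_ker.1 hy) ⟨b, hb⟩
    · refine Finset.sum_eq_zero fun a _ => ?_
      have : ¬ G.Adj a.1.1 b := fun hadj =>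
        hb (Finset.mem_filter.2 ⟨Finset.mem_univ b, a.1, a.2, hadj⟩)
      rw [← hA] at this
      rw [not_not.1 this, zero_mul]
  funext a
  rw [← hx a, hx_zero]; rfl

theorem IsObservable.parentSCCsObserved [DecidableEq V] (hA : HasStructure G A)
    (hC : IsOutputMatrix O C) (h : IsObservable A C) : ParentSCCsObserved G O := by
  rintro S ⟨⟨a, rfl⟩, hclosed, -⟩
  by_contra! hS
  set S := {b | Reaches G a b ∧ Reaches G b a}
  have haS : a ∈ S := ⟨.refl, .refl⟩
  let U : Submodule ℝ (V → ℝ) :=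
    { carrier := {x | ∀ v ∉ S, x v = 0}
      zero_mem' := fun v _ => rfl
      add_mem' := fun hx hy v hv => by simp [hx v hv, hy v hv]
      smul_mem' := fun c x hx v hv => by simp [hx v hv] }
  -- Vectors supported on `S` are invariant because no link leaves `S`.
  have hU := h.eq_bot_of_invariant U (fun x hx v hv => ?_) fun x hx =>
    mulVec_eq_zero_of_isOutputMatrix hC fun v hv => hx v fun hvS => hS v hvS hv
  · have hmem : Pi.single a (1 : ℝ) ∈ U := fun v hv =>
      Pi.single_eq_of_ne (fun hva : v = a => hv (hva ▸ haS)) _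
    rw [hU, Submodule.mem_bot] at hmem
    simpa using congrFun hmem a
  · refine Finset.sum_eq_zero fun w _ => ?_
    by_cases hw : w ∈ S
    · have : ¬ A v w ≠ 0 := fun hne => hv (hclosed w v hw ((hA w v).1 hne))
      exact mul_eq_zero_of_left (not_not.1 this) _
    · exact mul_eq_zero_of_right _ (hx w hw)

end Necessity

/-! ### The eigenvector (Hautus) test -/

theorem eq_bot_of_forall_eigenvector {E : Type*} [AddCommGroup E] [Module ℂ E]
    [FiniteDimensional ℂ E] {f : Module.End ℂ E} {K U : Submodule ℂ E}
    (h : ∀ (ν : ℂ), ∀ x ∈ K, f x = ν • x → x = 0) (hUK : U ≤ K) (hU : ∀ x ∈ U, f x ∈ U) :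
    U = ⊥ := by
  by_contra hne
  have : Nontrivial U := Submodule.nontrivial_iff_ne_bot.2 hne
  obtain ⟨ν, hν⟩ := Module.End.exists_eigenvalue (f.restrict hU)
  obtain ⟨x, hx⟩ := hν.exists_hasEigenvector
  refine hx.2 (Subtype.ext (h ν x (hUK x.2) ?_))
  exact congrArg Subtype.val hx.apply_eq_smul

/-- If `f` has no eigenvectors in `K`, then the resolvent `(ν - f)⁻¹ e` of a nonzero vector `e`
lies in `K` only for finitely many `ν`. -/
theorem finite_setOf_resolvent_mem {E : Type*} [AddCommGroup E] [Module ℂ E]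
    [FiniteDimensional ℂ E] {f : Module.End ℂ E} {K : Submodule ℂ E}
    (h : ∀ (ν : ℂ), ∀ x ∈ K, f x = ν • x → x = 0) {e : E} (he : e ≠ 0) :
    {ν : ℂ | ∃ z ∈ K, f z + e = ν • z}.Finite := by
  let Z := Submodule.span ℂ {z | z ∈ K ∧ ∃ ν : ℂ, f z + e = ν • z}
  -- Since `f z = ν • z - e`, having `e ∈ Z` would make `Z` an invariant subspace of `K`, hence
  -- zero.
  have heZ : e ∉ Z := by
    intro heZ
    have hZ : Z = ⊥ := by
      refine eq_bot_of_forall_eigenvector h (Submodule.span_le.2 fun z hz => hz.1) fun x hx => ?_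
      refine Submodule.span_induction (fun z hz => ?_) ?_ (fun x y _ _ hx hy => ?_)
        (fun c x _ hx => ?_) hx
      · obtain ⟨ν, hν⟩ := hz.2
        rw [eq_sub_of_add_eq hν]
        exact Z.sub_mem (Z.smul_mem ν (Submodule.subset_span hz)) heZ
      · simp
      · rw [map_add]; exact Z.add_mem hx hy
      · rw [map_smul]; exact Z.smul_mem c hx
    rw [hZ] at heZ
    exact he heZ
  obtain ⟨φ, hφe, hφZ⟩ := Submodule.exists_le_ker_of_notMem heZ
  -- For each such `z`, `φ z = 0` gives `φ (f z) = -φ e`, so the rank-one correction adds `e` back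
  -- and `B z = ν • z`. All these `ν` are eigenvalues of the single map `B`.
  let B : Module.End ℂ E := f - ((φ e)⁻¹ • φ.comp f).smulRight e
  refine (Module.End.finite_hasEigenvalue B).subset ?_
  rintro ν ⟨z, hzK, hz⟩
  have hzZ : φ z = 0 := hφZ (Submodule.subset_span ⟨hzK, ν, hz⟩)
  refine Module.End.hasEigenvalue_of_hasEigenvector (x := z)
    (Module.End.hasEigenvector_iff.2 ⟨Module.End.mem_eigenspace_iff.2 ?_, ?_⟩)
  · have hf : f z = ν • z - e := eq_sub_of_add_eq hz
    simp [B, hf, hzZ, hφe]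
  · rintro rfl
    simp at hz
    exact he hz

/-- No eigenvector of `A` over `ℂ` vanishes on `Y`. -/
def PassesHautus {V : Type*} [Fintype V] (A : Matrix V V ℝ) (Y : Set V) : Prop :=
  ∀ (ν : ℂ) (x : V → ℂ), A.map Complex.ofReal *ᵥ x = ν • x → (∀ v ∈ Y, x v = 0) → x = 0

/-- The complex vectors that vanish on `Y`. -/
def vanishingOn {V : Type*} (Y : Set V) : Submodule ℂ (V → ℂ) where
  carrier := {x | ∀ v ∈ Y, x v = 0}
  zero_mem' := fun _ _ => rfl
  add_mem' := fun hx hy v hv => by simp [hx v hv, hy v hv]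
  smul_mem' := fun c x hx v hv => by simp [hx v hv]

theorem PassesHautus.finite_resolvent {V : Type*} [Fintype V] {A : Matrix V V ℝ} {Y : Set V}
    (h : PassesHautus A Y) {e : V → ℂ} (he : e ≠ 0) :
    {ν : ℂ | ∃ z : V → ℂ, (∀ v ∈ Y, z v = 0) ∧
      A.map Complex.ofReal *ᵥ z + e = ν • z}.Finite :=
  finite_setOf_resolvent_mem (f := (A.map Complex.ofReal).mulVecLin) (K := vanishingOn Y)
    (fun ν x hx hxν => h ν x hxν hx) he

theorem PassesHautus.eq_zero_of_kalman {V : Type*} [Fintype V] [DecidableEq V]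
    {A : Matrix V V ℝ} {Y : Set V} (h : PassesHautus A Y) {x : V → ℝ}
    (hx : ∀ (k : ℕ), ∀ v ∈ Y, (A ^ k *ᵥ x) v = 0) : x = 0 := by
  let B := A.map Complex.ofReal
  let U : Submodule ℂ (V → ℂ) :=
    { carrier := {y | ∀ (k : ℕ), ∀ v ∈ Y, (B ^ k *ᵥ y) v = 0}
      zero_mem' := fun _ _ _ => by simp
      add_mem' := fun hx hy k v hv => by simp [mulVec_add, hx k v hv, hy k v hv]
      smul_mem' := fun c x hx k v hv => by simp [mulVec_smul, hx k v hv] }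
  have hU : U = ⊥ := eq_bot_of_forall_eigenvector (f := B.mulVecLin) (K := vanishingOn Y)
    (fun ν x hx hxν => h ν x hxν hx) (fun y hy v hv => by simpa using hy 0 v hv)
    fun y hy k v hv => by
      simpa [pow_succ] using hy (k + 1) v hv
  have hxU : (fun v => (x v : ℂ)) ∈ U := by
    intro k v hv
    have h1 : B ^ k = (A ^ k).map Complex.ofRealHom := (Matrix.map_pow A Complex.ofRealHom k).symm
    have h2 := RingHom.map_mulVec Complex.ofRealHom (A ^ k) x v
    rw [hx k v hv, map_zero] at h2
    rw [h1]
    exact h2.symm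
  rw [hU, Submodule.mem_bot] at hxU
  funext v
  simpa using congrFun hxU v

/-! ### An observable realization from a permutation and paths to the observed nodes -/

section Construction
variable {V : Type*} {G : Digraph V} {O : Finset V}

/-- Among the nodes reachable from `v`, one that reaches the fewest nodes lies in a component no
link leaves. -/
theorem ParentSCCsObserved.exists_reaches [Finite V] (h : ParentSCCsObserved G O)
    (hout : ∀ v ∉ O, ∃ w, G.Adj v w) (v : V) : ∃ o ∈ O, Reaches G v o := by
  obtain ⟨b, hvb, hmin⟩ := Set.exists_min_image {b | Reaches G v b}
    (fun b => {c | Reaches G b c}.ncard) (Set.toFinite _) ⟨v, .refl⟩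
  have hback : ∀ c, Reaches G b c → Reaches G c b := by
    intro c hbc
    have hsub : {d | Reaches G c d} ⊆ {d | Reaches G b d} := fun d hd => hbc.trans hd
    have := Set.eq_of_subset_of_ncard_le hsub (hmin c (hvb.trans hbc)) (Set.toFinite _)
    exact this.ge (show b ∈ {d | Reaches G b d} from .refl)
  by_cases hb : b ∈ O
  · exact ⟨b, hb, hvb⟩
  · obtain ⟨o, ho, hoO⟩ := h {c | Reaches G b c ∧ Reaches G c b} ⟨⟨b, rfl⟩,
      fun c d hc hcd => ⟨hc.1.tail hcd, hback d (hc.1.tail hcd)⟩,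
      ⟨b, ⟨.refl, .refl⟩, hout b hb⟩⟩
    exact ⟨o, hoO, hvb.trans ho.1⟩

theorem Reaches.exists_adj_of_notMem_of_mem {W : Set V} {a b : V} (h : Reaches G a b)
    (ha : a ∉ W) (hb : b ∈ W) : ∃ u w, u ∉ W ∧ w ∈ W ∧ G.Adj u w := by
  induction h using Relation.ReflTransGen.head_induction_on with
  | refl => exact absurd hb ha
  | @head a c hac _ ih =>
    by_cases hc : c ∈ W
    · exact ⟨_, c, ha, hc, hac⟩
    · exact ih hc

/-- `W` is a union of cycles of `σ` containing `O`, with an observable system living on `W` that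
uses only links of `G`. -/
def IsRealizableOn [Fintype V] (G : Digraph V) (O : Finset V) (σ : Equiv.Perm V) (W : Set V) :
    Prop :=
  (∀ o ∈ O, o ∈ W) ∧ (∀ v, σ v ∈ W ↔ v ∈ W) ∧ ∃ A : Matrix V V ℝ,
    (∀ a b, A b a ≠ 0 → G.Adj a b ∧ a ∈ W ∧ b ∈ W) ∧ PassesHautus A (O ∪ Wᶜ)

open Classical in
/-- The weighted links `a → σ a` for `a ∈ S`. -/
noncomputable def permMatrixOn (σ : Equiv.Perm V) (S : Set V) (μ : ℝ) : Matrix V V ℝ :=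
  Matrix.of fun b a => if a ∈ S ∧ b = σ a then μ else 0

theorem permMatrixOn_ne_zero {σ : Equiv.Perm V} {S : Set V} {μ : ℝ} {a b : V}
    (h : permMatrixOn σ S μ b a ≠ 0) : a ∈ S ∧ b = σ a := by
  by_contra hn
  exact h (by simp [permMatrixOn, hn])

open Classical in
theorem permMatrixOn_mulVec [Fintype V] (σ : Equiv.Perm V) (S : Set V) (μ : ℝ) (x : V → ℂ)
    (a : V) : ((permMatrixOn σ S μ).map Complex.ofReal *ᵥ x) (σ a) =
      if a ∈ S then μ * x a else 0 := by
  rw [mulVec, dotProduct, Finset.sum_eq_single a]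
  · by_cases ha : a ∈ S <;> simp [permMatrixOn, ha]
  · intro b _ hb
    simp [permMatrixOn, hb.symm]
  · simp

theorem exists_isRealizableOn [Fintype V] {σ : Equiv.Perm V} (hσ : ∀ v ∉ O, G.Adj v (σ v)) :
    ∃ W, IsRealizableOn G O σ W := by
  classical
  set W : Set V := {v | ∃ o ∈ O, σ.SameCycle v o}
  have hOW : ∀ o ∈ O, o ∈ W := fun o ho => ⟨o, ho, .refl _ _⟩
  have hW : ∀ v, σ v ∈ W ↔ v ∈ W := fun v => by
    simp [W, Equiv.Perm.sameCycle_apply_left]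
  refine ⟨W, hOW, hW, permMatrixOn σ (W \ O) 1, fun a b hab => ?_, fun ν x hx hxY => ?_⟩
  · obtain ⟨⟨haW, haO⟩, rfl⟩ := permMatrixOn_ne_zero hab
    exact ⟨hσ a haO, haW, (hW a).2 haW⟩
  -- The eigenvector equation reads `x v = ν * x (σ v)` on `W \ O`, so zeros propagate backwards
  -- along each cycle from `O`.
  · have key : ∀ (n : ℕ) (v : V), (σ ^ n) v ∈ O → x v = 0 := by
      intro n
      induction n with
      | zero => exact fun v hv => hxY v (Or.inl hv)
      | succ n ih =>
        intro v hv
        by_cases hvY : v ∈ (O ∪ Wᶜ : Set V)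
        · exact hxY v hvY
        have hvS : v ∈ W \ (O : Set V) := by
          simp only [Set.mem_union, Set.mem_compl_iff, not_or, not_not] at hvY
          exact ⟨hvY.2, hvY.1⟩
        have h1 := congrFun hx (σ v)
        rw [permMatrixOn_mulVec, if_pos hvS, Pi.smul_apply,
          ih (σ v) (by rwa [pow_succ, Equiv.Perm.mul_apply] at hv)] at h1
        simpa using h1
    funext v
    by_cases hv : v ∈ W
    · obtain ⟨o, ho, hvo⟩ := hv
      obtain ⟨n, -, hn⟩ := hvo.exists_pow_eq'
      exact key n v (hn ▸ ho)
    · exact hxY v (Or.inr hv)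

/-- Give the new cycle weight `μ` and the link `u → w` weight 1. An eigenvector with `x u ≠ 0` has
`‖ν‖ = μ` by going round the cycle, while its part on `W`, divided by `x u`, solves a resolvent
equation possible for finitely many `ν` only; `μ` avoids their moduli. Hence `x u = 0`, and both
parts vanish. -/
theorem IsRealizableOn.extend [Fintype V] {σ : Equiv.Perm V} (hσ : ∀ v ∉ O, G.Adj v (σ v))
    {W : Set V} (h : IsRealizableOn G O σ W) {u w : V} (hu : u ∉ W) (hw : w ∈ W)
    (huw : G.Adj u w) : IsRealizableOn G O σ (W ∪ {v | σ.SameCycle u v}) := by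
  classical
  obtain ⟨hOW, hW, A, hA, hH⟩ := h
  set S : Set V := {v | σ.SameCycle u v}
  have hS : ∀ v, σ v ∈ S ↔ v ∈ S := fun v => Equiv.Perm.sameCycle_apply_right
  have huS : u ∈ S := .refl _ _
  have hWpow : ∀ (n : ℕ) v, (σ ^ n) v ∈ W ↔ v ∈ W := by
    intro n
    induction n with
    | zero => simp
    | succ n ih => intro v; rw [pow_succ, Equiv.Perm.mul_apply, ih, hW]
  have hSW : ∀ v ∈ S, v ∉ W := by
    intro v hv hvW
    obtain ⟨n, -, hn⟩ := Equiv.Perm.SameCycle.exists_pow_eq' hv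
    exact hu ((hWpow n u).1 (hn ▸ hvW))
  have he : (Pi.single w 1 : V → ℂ) ≠ 0 := by simp
  obtain ⟨μ, hμ⟩ := ((hH.finite_resolvent he).image fun ν => ‖ν‖).bddAbove
  obtain ⟨μ, hμ0, hμ⟩ : ∃ μ : ℝ, 0 < μ ∧ ∀ (ν : ℂ) (z : V → ℂ),
      (∀ v ∈ (O ∪ Wᶜ : Set V), z v = 0) →
        A.map Complex.ofReal *ᵥ z + Pi.single w 1 = ν • z → ‖ν‖ ≠ μ := by
    -- Positive and beyond every resonant modulus.
    refine ⟨max μ 0 + 1, by positivity, fun ν z hz hν hn => ?_⟩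
    have := hμ ⟨ν, ⟨z, hz, hν⟩, rfl⟩
    have := le_max_left μ 0
    simp only [hn] at *
    linarith
  refine ⟨fun o ho => Or.inl (hOW o ho), fun v => or_congr (hW v) (hS v),
    A + permMatrixOn σ S μ + Matrix.single w u 1, fun a b hab => ?_, fun ν x hx hxY => ?_⟩
  · by_cases h1 : A b a ≠ 0
    · obtain ⟨h2, h3, h4⟩ := hA a b h1
      exact ⟨h2, Or.inl h3, Or.inl h4⟩
    by_cases h2 : permMatrixOn σ S μ b a ≠ 0
    · obtain ⟨haS, rfl⟩ := permMatrixOn_ne_zero h2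
      exact ⟨hσ a fun haO => hSW a haS (hOW a haO), Or.inr haS, Or.inr ((hS a).2 haS)⟩
    · rw [not_not] at h1 h2
      rw [Matrix.add_apply, Matrix.add_apply, h1, h2, Matrix.single_apply, zero_add, zero_add] at hab
      obtain ⟨rfl, rfl⟩ := of_not_not fun hn => hab (if_neg hn)
      exact ⟨huw, Or.inr huS, Or.inl hw⟩
  set B := A.map Complex.ofReal
  have hB : ∀ a b, B b a ≠ 0 → a ∈ W ∧ b ∈ W := fun a b hab =>
    (hA a b fun h0 => hab (by simp [B, h0])).2
  have hrow : ∀ a, (B *ᵥ x) (σ a) + (if a ∈ S then μ * x a else 0) +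
      (if σ a = w then x u else 0) = ν * x (σ a) := by
    intro a
    have h1 := congrFun hx (σ a)
    have h2 : (A + permMatrixOn σ S μ + Matrix.single w u 1).map Complex.ofReal =
        B + (permMatrixOn σ S μ).map Complex.ofReal + Matrix.single w u 1 := by
      ext i j
      simp [B, Matrix.single_apply, apply_ite Complex.ofReal]
    rw [h2, add_mulVec, add_mulVec, Pi.add_apply, Pi.add_apply, permMatrixOn_mulVec] at h1
    rw [Pi.smul_apply, smul_eq_mul] at h1
    rw [← h1, Matrix.single_mulVec]
    simp [Function.update_apply]
  have hBrow : ∀ (y : V → ℂ), ∀ b ∉ W, (B *ᵥ y) b = 0 := fun y b hb =>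
    Finset.sum_eq_zero fun a _ => mul_eq_zero_of_left (not_not.1 fun h => hb (hB a b h).2) _
  have hcycle : ∀ a ∈ S, μ * x a = ν * x (σ a) := by
    intro a ha
    have hσa : σ a ∉ W := hSW _ ((hS a).2 ha)
    have := hrow a
    rwa [hBrow x _ hσa, if_pos ha, if_neg fun h : σ a = w => hσa (h ▸ hw), zero_add, add_zero] at this
  let z : V → ℂ := fun v => if v ∈ W then x v else 0
  have hBz : B *ᵥ z = B *ᵥ x := by
    funext b
    refine Finset.sum_congr rfl fun a _ => ?_
    by_cases ha : a ∈ W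
    · simp [z, ha]
    · have : B b a = 0 := not_not.1 fun h => ha (hB a b h).1
      simp [this]
  have hz : B *ᵥ z + x u • Pi.single w 1 = ν • z := by
    funext b
    obtain ⟨a, rfl⟩ := σ.surjective b
    by_cases hb : σ a ∈ W
    · have := hrow a
      rw [if_neg fun ha => hSW _ ((hS a).2 ha) hb, add_zero] at this
      simp [hBz, z, hb, Pi.single_apply, this]
    · have : σ a ≠ w := fun h => hb (h ▸ hw)
      simp [hBrow z _ hb, z, hb, this]
  have hzY : ∀ v ∈ (O ∪ Wᶜ : Set V), z v = 0 := by
    intro v hv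
    by_cases hvW : v ∈ W
    · rw [show z v = x v from if_pos hvW]
      exact hxY v (Or.inl (hv.resolve_right fun h => h hvW))
    · exact if_neg hvW
  have hpow : ∀ n : ℕ, (μ : ℂ) ^ n * x u = ν ^ n * x ((σ ^ n) u) := by
    intro n
    induction n with
    | zero => simp
    | succ n ih =>
      have hn : (σ ^ n) u ∈ S := ⟨n, by simp⟩
      have := hcycle _ hn
      rw [pow_succ' σ, Equiv.Perm.mul_apply, pow_succ', mul_assoc, ih, pow_succ]
      linear_combination ν ^ n * this
  have hxu : x u = 0 := by
    by_contra hxu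
    have h1 := hpow (orderOf σ)
    rw [pow_orderOf_eq_one, Equiv.Perm.one_apply] at h1
    have h2 : ‖ν‖ = μ := by
      have := congrArg norm (mul_right_cancel₀ hxu h1)
      rw [norm_pow, norm_pow, Complex.norm_real, Real.norm_of_nonneg hμ0.le] at this
      exact (pow_left_inj₀ (norm_nonneg _) hμ0.le (orderOf_pos σ).ne').1 this.symm
    refine hμ ν ((x u)⁻¹ • z) (fun v hv => by simp [hzY v hv]) ?_ h2
    rw [mulVec_smul, smul_comm ν, ← hz, smul_add, smul_smul, inv_mul_cancel₀ hxu, one_smul]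
  have hz0 : z = 0 := hH ν z (by rw [← hz, hxu, zero_smul, add_zero]) hzY
  have hμC : (μ : ℂ) ≠ 0 := Complex.ofReal_ne_zero.2 hμ0.ne'
  have hxS : ∀ v ∈ S, x v = 0 := by
    intro v hv
    by_cases hν : ν = 0
    · have := hcycle v hv
      rw [hν, zero_mul] at this
      exact (mul_eq_zero.1 this).resolve_left hμC
    · obtain ⟨n, -, rfl⟩ := Equiv.Perm.SameCycle.exists_pow_eq' hv
      have := hpow n
      rw [hxu, mul_zero] at this
      exact (mul_eq_zero.1 this.symm).resolve_left (pow_ne_zero n hν)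
  funext v
  by_cases hvW : v ∈ W
  · have := congrFun hz0 v
    simpa [z, hvW] using this
  by_cases hvS : v ∈ S
  · exact hxS v hvS
  · exact hxY v (Or.inr fun h => h.elim hvW hvS)

/-- A maximal realizable `W` is everything: a path to `O` from a node outside `W` would enter `W` by
a link, allowing an extension. -/
theorem exists_passesHautus [Fintype V] (h1 : UnmatchedObserved G O)
    (h2 : ParentSCCsObserved G O) :
    ∃ A : Matrix V V ℝ, (∀ a b, A b a ≠ 0 → G.Adj a b) ∧ PassesHautus A O := by
  obtain ⟨σ, hσ⟩ := h1.exists_perm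
  obtain ⟨W, hW⟩ := (Set.toFinite {W | IsRealizableOn G O σ W}).exists_maximal
    (exists_isRealizableOn hσ)
  have huniv : ∀ v, v ∈ W := by
    intro v
    by_contra hv
    obtain ⟨o, ho, hvo⟩ := h2.exists_reaches (fun v hv => ⟨σ v, hσ v hv⟩) v
    obtain ⟨u, w, hu, hw, huw⟩ := hvo.exists_adj_of_notMem_of_mem hv (hW.1.1 o ho)
    exact hu (hW.2 (hW.1.extend hσ hu hw huw) Set.subset_union_left (Or.inr (.refl _ _)))
  obtain ⟨-, -, A, hA, hH⟩ := hW.1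
  exact ⟨A, fun a b hab => (hA a b hab).1, fun ν x hx hxO =>
    hH ν x hx fun v hv => hxO v (hv.resolve_right fun h => h (huniv v))⟩

end Construction

/-! ### Genericity -/

open MeasureTheory in
/-- A continuous function that, on every line through `p₀`, has only a null set of zeros,
vanishes only on a null set. -/
theorem ae_ne_zero_of_lines {E : Type*} [NormedAddCommGroup E] [NormedSpace ℝ E]
    [FiniteDimensional ℝ E] [MeasurableSpace E] [BorelSpace E] (μ : Measure E)
    [μ.IsAddHaarMeasure] {F : E → ℝ} (hF : Continuous F) (p₀ : E)
    (h : ∀ v : E, ∀ᵐ t : ℝ, F (p₀ + t • v) ≠ 0) : ∀ᵐ p ∂μ, F p ≠ 0 := by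
  have hmeas : MeasurableSet {q : E × ℝ | F (p₀ + q.2 • q.1) ≠ 0} :=
    ((isClosed_singleton (x := (0 : ℝ))).preimage
      (f := fun q : E × ℝ => F (p₀ + q.2 • q.1)) (by fun_prop)).measurableSet.compl
  -- Fubini swaps the quantifiers; for one good `t ≠ 0` the map `v ↦ p₀ + t • v` preserves null sets
  -- in both directions.
  have h1 : ∀ᵐ t : ℝ, ∀ᵐ v ∂μ, F (p₀ + t • v) ≠ 0 :=
    (Measure.ae_ae_comm (μ := μ) (ν := (volume : Measure ℝ)) hmeas).1 (ae_of_all _ h)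
  obtain ⟨t, ht, ht0⟩ := (h1.and (Measure.ae_ne volume (0 : ℝ))).exists
  have h2 : μ ((fun v => t • v) ⁻¹' ((fun p => p₀ + p) ⁻¹' {p | F p = 0})) = 0 := by
    simpa [ae_iff] using ht
  rw [Measure.addHaar_preimage_smul μ ht0, measure_preimage_add, mul_eq_zero] at h2
  have h3 := h2.resolve_left (by simp [ht0])
  simpa [ae_iff] using h3

/-! ### The Gram determinant as a test of observability -/

section Gram
variable {V P R : Type*} [Fintype V] [DecidableEq V] [Fintype P] [CommRing R]

/-- The Gram matrix of the observability matrix. -/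
def observabilityGram (A : Matrix V V R) (C : Matrix P V R) : Matrix V V R :=
  ∑ k ∈ Finset.range (Fintype.card V), (C * A ^ k)ᵀ * (C * A ^ k)

theorem map_observabilityGram {S : Type*} [CommRing S] (f : R →+* S) (A : Matrix V V R)
    (C : Matrix P V R) :
    (observabilityGram A C).map f = observabilityGram (A.map f) (C.map f) := by
  have : (observabilityGram A C).map f = ∑ k ∈ Finset.range (Fintype.card V),
      ((C * A ^ k)ᵀ * (C * A ^ k)).map f := map_sum f.mapMatrix.toAddMonoidHom _ _
  rw [this, observabilityGram]
  refine Finset.sum_congr rfl fun k _ => ?_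
  rw [Matrix.map_mul, Matrix.transpose_map, Matrix.map_mul, Matrix.map_pow]

end Gram

section RealGram
variable {V P : Type*} [Fintype V] [DecidableEq V] {A : Matrix V V ℝ}
  {C : Matrix P V ℝ}

theorem pow_mulVec_eq_zero_of_forall_lt {x : V → ℝ}
    (h : ∀ k < Fintype.card V, (C * A ^ k) *ᵥ x = 0) (k : ℕ) : (C * A ^ k) *ᵥ x = 0 := by
  -- For empty `V` the degree bound on the Cayley–Hamilton remainder fails: `natDegree` is never
  -- below 0.
  cases isEmpty_or_nonempty V
  · rw [Subsingleton.elim x 0, mulVec_zero]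
  rw [Matrix.pow_eq_aeval_mod_charpoly, Polynomial.aeval_eq_sum_range' (n := Fintype.card V),
    Matrix.mul_sum, Matrix.sum_mulVec]
  · refine Finset.sum_eq_zero fun i hi => ?_
    rw [Matrix.mul_smul, smul_mulVec, h i (Finset.mem_range.1 hi), smul_zero]
  · rw [← A.charpoly_natDegree_eq_dim]
    exact Polynomial.natDegree_modByMonic_lt _ A.charpoly_monic fun h1 => by
      have := A.charpoly_natDegree_eq_dim
      rw [h1, Polynomial.natDegree_one] at this
      exact Fintype.card_ne_zero this.symm

/-- The quadratic form of the Gram matrix at `x` is the sum of the squared norms of the `(C * A ^ k)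
*ᵥ x`. -/
theorem observabilityGram_mulVec_eq_zero [Fintype P] {x : V → ℝ} :
    observabilityGram A C *ᵥ x = 0 ↔ ∀ k < Fintype.card V, (C * A ^ k) *ᵥ x = 0 := by
  rw [observabilityGram, Matrix.sum_mulVec]
  constructor
  · intro h
    have h1 := congrArg (x ⬝ᵥ ·) h
    simp only [dotProduct_sum, dotProduct_zero] at h1
    have h2 : ∀ k, x ⬝ᵥ (((C * A ^ k)ᵀ * (C * A ^ k)) *ᵥ x) =
        ((C * A ^ k) *ᵥ x) ⬝ᵥ ((C * A ^ k) *ᵥ x) := fun k => by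
      rw [← mulVec_mulVec, dotProduct_mulVec, vecMul_transpose]
    simp only [h2] at h1
    rw [Finset.sum_eq_zero_iff_of_nonneg fun k _ =>
      show 0 ≤ ((C * A ^ k) *ᵥ x) ⬝ᵥ ((C * A ^ k) *ᵥ x) from
        Finset.sum_nonneg fun i _ => mul_self_nonneg _] at h1
    exact fun k hk => dotProduct_self_eq_zero.1 (h1 k (Finset.mem_range.2 hk))
  · intro h
    refine Finset.sum_eq_zero fun k hk => ?_
    rw [← mulVec_mulVec, h k (Finset.mem_range.1 hk), mulVec_zero]

theorem isObservable_of_det_observabilityGram_ne_zero [Fintype P]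
    (h : (observabilityGram A C).det ≠ 0) :
    IsObservable A C :=
  isObservable_of_kalman fun _ hx => of_not_not fun hne => h
    (exists_mulVec_eq_zero_iff.1 ⟨_, hne, observabilityGram_mulVec_eq_zero.2 fun k _ => hx k⟩)

theorem det_observabilityGram_ne_zero [Fintype P]
    (h : ∀ x : V → ℝ, (∀ k, (C * A ^ k) *ᵥ x = 0) → x = 0) :
    (observabilityGram A C).det ≠ 0 := by
  intro h0
  obtain ⟨x, hne, hx⟩ := exists_mulVec_eq_zero_iff.2 h0
  exact hne (h x (pow_mulVec_eq_zero_of_forall_lt (observabilityGram_mulVec_eq_zero.1 hx)))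

end RealGram

/-! ### From one observable system to almost all weights -/

section Generic
variable {V : Type*} [Fintype V] [DecidableEq V] {G : Digraph V} [DecidableRel G.Adj]
  {O : Finset V}

theorem outputMatrix_mulVec (c : O → ℝ) (x : V → ℝ) (o : O) :
    (outputMatrix O c *ᵥ x) o = c o * x o := by
  simp [outputMatrix, mulVec, dotProduct, ite_mul]

theorem continuous_det_observabilityGram :
    Continuous fun p : (Link G → ℝ) × (O → ℝ) =>
      (observabilityGram (systemMatrix G p.1) (outputMatrix O p.2)).det := by
  have hA : Continuous fun p : (Link G → ℝ) × (O → ℝ) => systemMatrix G p.1 := by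
    refine continuous_matrix fun b a => ?_
    by_cases h : G.Adj a b
    · simp only [systemMatrix, of_apply, h, dite_true]; fun_prop
    · simp only [systemMatrix, of_apply, h, dite_false]; fun_prop
  have hC : Continuous fun p : (Link G → ℝ) × (O → ℝ) => outputMatrix O p.2 := by
    refine continuous_matrix fun o v => ?_
    by_cases h : v = o
    · simp only [outputMatrix, of_apply, h, if_true]; fun_prop
    · simp only [outputMatrix, of_apply, h, if_false]; fun_prop
  refine Continuous.matrix_det (continuous_finsetSum _ fun k _ => ?_)
  exact (hC.matrix_mul (hA.pow k)).matrix_transpose.matrix_mul (hC.matrix_mul (hA.pow k))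

open Polynomial in
-- Entries are affine along a line, so the determinant can be formed over `ℝ[X]` and evaluated
-- afterwards.
theorem exists_polynomial_det_observabilityGram (p v : (Link G → ℝ) × (O → ℝ)) :
    ∃ q : ℝ[X], ∀ t : ℝ, q.eval t =
      (observabilityGram (systemMatrix G (p + t • v).1) (outputMatrix O (p + t • v).2)).det := by
  refine ⟨(observabilityGram
    (Matrix.of fun b a => C (systemMatrix G p.1 b a) + X * C (systemMatrix G v.1 b a))
    (Matrix.of fun o a => C (outputMatrix O p.2 o a) + X * C (outputMatrix O v.2 o a))).det,
    fun t => ?_⟩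
  rw [← coe_evalRingHom, RingHom.map_det, RingHom.mapMatrix_apply, map_observabilityGram]
  congr 2
  · ext b a
    by_cases h : G.Adj a b <;> simp [systemMatrix, h, mul_comm t]
  · ext o a
    by_cases h : a = o <;> simp [outputMatrix, h, mul_comm t]

theorem isGenericallyObservable_of_conditions (h1 : UnmatchedObserved G O)
    (h2 : ParentSCCsObserved G O) : IsGenericallyObservable G O := by
  obtain ⟨A, hA, hH⟩ := exists_passesHautus h1 h2
  let p₀ : (Link G → ℝ) × (O → ℝ) := (fun e => A e.1.2 e.1.1, fun _ => 1)
  have hAp : systemMatrix G p₀.1 = A := by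
    ext b a
    by_cases h : G.Adj a b
    · simp [systemMatrix, p₀, h]
    · simp [systemMatrix, h, not_not.1 fun hne => h (hA a b hne)]
  have hdet : (observabilityGram (systemMatrix G p₀.1) (outputMatrix O p₀.2)).det ≠ 0 := by
    refine det_observabilityGram_ne_zero fun x hx => ?_
    rw [hAp] at hx
    refine hH.eq_zero_of_kalman fun k v hv => ?_
    have := congrFun (hx k) ⟨v, hv⟩
    rw [← mulVec_mulVec, outputMatrix_mulVec] at this
    simpa [p₀] using this
  have : ((MeasureTheory.volume : MeasureTheory.Measure (Link G → ℝ)).prod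
      (MeasureTheory.volume : MeasureTheory.Measure (O → ℝ))).IsAddHaarMeasure :=
    MeasureTheory.Measure.prod.instIsAddHaarMeasure _ _
  refine (ae_ne_zero_of_lines (MeasureTheory.volume.prod MeasureTheory.volume)
    continuous_det_observabilityGram p₀ fun v => ?_).mono
    fun p hp => isObservable_of_det_observabilityGram_ne_zero hp
  obtain ⟨q, hq⟩ := exists_polynomial_det_observabilityGram p₀ v
  have hq0 : q ≠ 0 := by
    rintro rfl
    have := hq 0
    rw [zero_smul, add_zero] at this
    exact hdet (by simpa using this.symm)
  simp only [← hq]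
  rw [MeasureTheory.ae_iff]
  simpa [Polynomial.IsRoot] using (q.finite_setOfPred_isRoot hq0).measure_zero MeasureTheory.volume

/-- Each coordinate hyperplane is null, so some observable parameter has no zero entry and realizes
the pattern exactly. -/
theorem IsGenericallyObservable.isStructurallyObservable (h : IsGenericallyObservable G O) :
    IsStructurallyObservable G O := by
  have hw : ∀ᵐ p : (Link G → ℝ) × (O → ℝ), (∀ e, p.1 e ≠ 0) ∧ ∀ o, p.2 o ≠ 0 := by
    refine (MeasureTheory.ae_all_iff.2 fun e => ?_).and (MeasureTheory.ae_all_iff.2 fun o => ?_)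
    · exact MeasureTheory.Measure.quasiMeasurePreserving_fst.ae (p := fun x : Link G → ℝ => x e ≠ 0)
        ((MeasureTheory.Measure.quasiMeasurePreserving_eval (fun _ => MeasureTheory.volume) e).ae
          (p := fun t => t ≠ 0) (MeasureTheory.volume.ae_ne (0 : ℝ)))
    · exact MeasureTheory.Measure.quasiMeasurePreserving_snd.ae (p := fun x : O → ℝ => x o ≠ 0)
        ((MeasureTheory.Measure.quasiMeasurePreserving_eval (fun _ => MeasureTheory.volume) o).ae
          (p := fun t => t ≠ 0) (MeasureTheory.volume.ae_ne (0 : ℝ)))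
  obtain ⟨p, hp, hp1, hp2⟩ := (h.and hw).exists
  refine ⟨_, _, fun a b => ?_, fun o v => ?_, hp⟩
  · by_cases h : G.Adj a b <;> simp [systemMatrix, h, hp1]
  · by_cases h : v = o <;> simp [outputMatrix, h, hp2]

end Generic

theorem IsStructurallyObservable.conditions {V : Type*} [Fintype V] [DecidableEq V]
    {G : Digraph V} {O : Finset V} (h : IsStructurallyObservable G O) :
    UnmatchedObserved G O ∧ ParentSCCsObserved G O := by
  obtain ⟨A, C, hA, hC, h⟩ := h
  exact ⟨h.unmatchedObserved hA hC, h.parentSCCsObserved hA hC⟩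

end StructObs

theorem theorem2 {V : Type*} [Fintype V] [DecidableEq V] (G : Digraph V) [DecidableRel G.Adj]
    (O : Finset V) :
    (StructObs.IsStructurallyObservable G O ↔
      StructObs.UnmatchedObserved G O ∧ StructObs.ParentSCCsObserved G O) ∧
    (StructObs.IsGenericallyObservable G O ↔
      StructObs.UnmatchedObserved G O ∧ StructObs.ParentSCCsObserved G O) := by
  have hgen : StructObs.UnmatchedObserved G O ∧ StructObs.ParentSCCsObserved G O →
      StructObs.IsGenericallyObservable G O :=
    fun h => StructObs.isGenericallyObservable_of_conditions h.1 h.2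
  exact ⟨⟨fun h => h.conditions, fun h => (hgen h).isStructurallyObservable⟩,
    fun h => h.isStructurallyObservable.conditions, hgen⟩
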